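/- Let $0\le a,b\le 1$ and let $$T=\begin{pmatrix} a & 1-b\\ 1-a & b\end{pmatrix}.$$ A qubit channel is a completely positive trace-preserving linear map $\Phi$ on the complex $2\times2$ matrices. It has classical action $T$ if $\langle k|\Phi(|l\rangle\langle l|)|k\rangle=T_{kl}$ for all $k,l$, where $\{|k\rangle\}$ is the fixed standard basis. Channels $\Phi^{(1)},\dots,\Phi^{(M)}$ are perfectly distinguishable if there are a finite-dimensional ancilla, a (possibly entangled) state $\rho$ of the qubit and the ancilla, and a measurement (POVM) $\{E_1,\dots,E_M\}$ such that $$\frac1M\sum_{n=1}^{M}\operatorname{tr}\bigl[E_n\,(\Phi^{(n)}\otimes\mathcal I)(\rho)\bigr]=1,$$ i.e. a channel drawn uniformly at random from the list is identified with probability one by a single use. The distinguishability number $\mathcal M(T)$ is the largest number $M$ for which there exist $M$ perfectly distinguishable qubit channels that all have classical action $T$. Then $$\mathcal M(T)=\begin{cases}2 & \text{if } 0<|a-b|\le \tfrac12,\\[2pt] 3 & \text{if } a=b \text{ and } a\in[\tfrac13,\tfrac23]\setminus\{\tfrac12\},\\[2pt] 4 & \text{if } a=b=\tfrac12.\end{cases}$$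 -/

import Mathlib

namespace QubitDist

open Matrix
open scoped ComplexOrder

/-- Linear maps (superoperators) on the `d × d` complex matrices. -/
abbrev Superop (d : ℕ) : Type :=
  Matrix (Fin d) (Fin d) ℂ →ₗ[ℂ] Matrix (Fin d) (Fin d) ℂ

/-- The extended map `Φ ⊗ I` on operators on `ℂ^d ⊗ ℂ^r`, where `I` is the identity map on
the `r × r` matrices: for each pair `k, l` of basis indices of the ancilla, `Φ` acts on the
block `(i, j) ↦ X (i, k) (j, l)`. -/
def ampliate {d : ℕ} (Φ : Superop d) (r : ℕ)
    (X : Matrix (Fin d × Fin r) (Fin d × Fin r) ℂ) :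
    Matrix (Fin d × Fin r) (Fin d × Fin r) ℂ :=
  Matrix.of fun p q => Φ (Matrix.of fun i j => X (i, p.2) (j, q.2)) p.1 q.1

/-- A quantum channel: a completely positive trace preserving map. -/
structure IsChannel {d : ℕ} (Φ : Superop d) : Prop where
  completelyPositive : ∀ (r : ℕ) (X : Matrix (Fin d × Fin r) (Fin d × Fin r) ℂ),
    X.PosSemidef → (ampliate Φ r X).PosSemidef
  tracePreserving : ∀ X : Matrix (Fin d) (Fin d) ℂ, (Φ X).trace = X.trace

/-- `Φ` has classical action `T`, i.e. `⟨k| Φ(|l⟩⟨l|) |k⟩ = T k l` for all `k, l`. -/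
def HasClassicalAction {d : ℕ} (Φ : Superop d) (T : Matrix (Fin d) (Fin d) ℝ) : Prop :=
  ∀ k l : Fin d, Φ (Matrix.single l l 1) k k = (T k l : ℂ)

/-- A density matrix (quantum state). -/
structure IsState {n : Type*} [Fintype n] (ρ : Matrix n n ℂ) : Prop where
  posSemidef : ρ.PosSemidef
  trace_eq_one : ρ.trace = 1

/-- A general quantum measurement (POVM) with outcomes in `Fin M`. -/
structure IsPOVM {n : Type*} [Fintype n] [DecidableEq n] {M : ℕ}
    (E : Fin M → Matrix n n ℂ) : Prop where
  posSemidef : ∀ m, (E m).PosSemidef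
  sum_eq_one : ∑ m, E m = 1

/-- The probability of identifying correctly a channel drawn uniformly from `Φ 0, …, Φ (M-1)`,
when it acts once on the first part of the bipartite input `ρ`, the output is measured with
the POVM `E`, and the outcome is the guess. -/
noncomputable def successProb {d r M : ℕ} (Φ : Fin M → Superop d)
    (ρ : Matrix (Fin d × Fin r) (Fin d × Fin r) ℂ)
    (E : Fin M → Matrix (Fin d × Fin r) (Fin d × Fin r) ℂ) : ℝ :=
  (1 / (M : ℝ)) * ∑ m, ((E m * ampliate (Φ m) r ρ).trace).re

/-- The channels `Φ 0, …, Φ (M-1)` are perfectly distinguishable: some single-use protocol, with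
a (possibly entangled) input state on the system and a finite-dimensional ancilla, and a
general measurement of the output, succeeds with probability one. -/
def PerfectlyDistinguishable {d M : ℕ} (Φ : Fin M → Superop d) : Prop :=
  ∃ (r : ℕ) (ρ : Matrix (Fin d × Fin r) (Fin d × Fin r) ℂ)
    (E : Fin M → Matrix (Fin d × Fin r) (Fin d × Fin r) ℂ),
    IsState ρ ∧ IsPOVM E ∧ successProb Φ ρ E = 1

/-- The numbers `M` for which there are `M` perfectly distinguishable quantum channels, all with
classical action `T`. -/
def distinguishableCounts {d : ℕ} (T : Matrix (Fin d) (Fin d) ℝ) : Set ℕ :=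
  {M | ∃ Φ : Fin M → Superop d,
    (∀ m, IsChannel (Φ m)) ∧ (∀ m, HasClassicalAction (Φ m) T) ∧ PerfectlyDistinguishable Φ}

/-- `N` is the distinguishability number of `T`: the maximal number of quantum channels with
classical action `T` that can be perfectly distinguished. -/
def IsDistinguishabilityNumber {d : ℕ} (T : Matrix (Fin d) (Fin d) ℝ) (N : ℕ) : Prop :=
  IsGreatest (distinguishableCounts T) N

/-- The qubit classical action with parameters `a, b`. -/
def qubitAction (a b : ℝ) : Matrix (Fin 2) (Fin 2) ℝ :=
  !![a, 1 - b; 1 - a, b]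

end QubitDist

namespace QubitDist

open Matrix
open scoped ComplexOrder Kronecker

/-- The completely positive map with Kraus operators `K j`. -/
def krausMap {ι : Type*} [Fintype ι] {d : ℕ} (K : ι → Matrix (Fin d) (Fin d) ℂ) : Superop d where
  toFun X := ∑ j, K j * X * (K j)ᴴ
  map_add' X Y := by simp [mul_add, add_mul, Finset.sum_add_distrib]
  map_smul' c X := by simp [Finset.smul_sum]

theorem krausMap_apply {ι : Type*} [Fintype ι] {d : ℕ} (K : ι → Matrix (Fin d) (Fin d) ℂ)
    (X : Matrix (Fin d) (Fin d) ℂ) : krausMap K X = ∑ j, K j * X * (K j)ᴴ := rfl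

theorem kronecker_one_mulVec {d r : ℕ} (K : Matrix (Fin d) (Fin d) ℂ)
    (Ψ : Matrix (Fin d) (Fin r) ℂ) :
    (K ⊗ₖ (1 : Matrix (Fin r) (Fin r) ℂ)) *ᵥ Function.uncurry Ψ = Function.uncurry (K * Ψ) := by
  ext ⟨k, q⟩
  simp [mulVec, dotProduct, Fintype.sum_prod_type, mul_apply, one_apply, Function.uncurry]

theorem ampliate_krausMap {ι : Type*} [Fintype ι] {d : ℕ} (K : ι → Matrix (Fin d) (Fin d) ℂ)
    (r : ℕ) (X : Matrix (Fin d × Fin r) (Fin d × Fin r) ℂ) :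
    ampliate (krausMap K) r X =
      ∑ j, (K j ⊗ₖ (1 : Matrix (Fin r) (Fin r) ℂ)) * X *
        (K j ⊗ₖ (1 : Matrix (Fin r) (Fin r) ℂ))ᴴ := by
  ext ⟨k, q⟩ ⟨k', q'⟩
  simp [ampliate, krausMap_apply, Matrix.sum_apply, mul_apply, Fintype.sum_prod_type, one_apply,
    Finset.sum_mul, apply_ite (starRingEnd ℂ)]

theorem ampliate_krausMap_vecMulVec {ι : Type*} [Fintype ι] {d : ℕ}
    (K : ι → Matrix (Fin d) (Fin d) ℂ) (r : ℕ) (Ψ : Matrix (Fin d) (Fin r) ℂ) :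
    ampliate (krausMap K) r (vecMulVec (Function.uncurry Ψ) (star (Function.uncurry Ψ))) =
      ∑ j, vecMulVec (Function.uncurry (K j * Ψ)) (star (Function.uncurry (K j * Ψ))) := by
  rw [ampliate_krausMap]
  refine Finset.sum_congr rfl fun j _ => ?_
  rw [mul_vecMulVec, vecMulVec_mul, ← star_mulVec, kronecker_one_mulVec]

theorem ampliate_sum {ι : Type*} (s : Finset ι) {d : ℕ} (Φ : Superop d) (r : ℕ)
    (X : ι → Matrix (Fin d × Fin r) (Fin d × Fin r) ℂ) :
    ampliate Φ r (∑ i ∈ s, X i) = ∑ i ∈ s, ampliate Φ r (X i) := by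
  ext p q
  have h : (Matrix.of fun i j => (∑ x ∈ s, X x) (i, p.2) (j, q.2) : Matrix (Fin d) (Fin d) ℂ) =
      ∑ x ∈ s, Matrix.of fun i j => X x (i, p.2) (j, q.2) := by
    ext i j
    simp [Matrix.sum_apply]
  simp only [ampliate, of_apply, h, map_sum]
  simp only [Matrix.sum_apply, of_apply]

theorem trace_ampliate {d : ℕ} {Φ : Superop d} (hΦ : IsChannel Φ) (r : ℕ)
    (X : Matrix (Fin d × Fin r) (Fin d × Fin r) ℂ) : (ampliate Φ r X).trace = X.trace := by
  have h (q : Fin r) := hΦ.tracePreserving (Matrix.of fun i j => X (i, q) (j, q))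
  simp only [trace, diag_apply, of_apply] at h
  simp only [trace, diag_apply, Fintype.sum_prod_type_right, ampliate, of_apply, h]

theorem isChannel_krausMap {ι : Type*} [Fintype ι] {d : ℕ} {K : ι → Matrix (Fin d) (Fin d) ℂ}
    (hK : ∑ j, (K j)ᴴ * K j = 1) : IsChannel (krausMap K) where
  completelyPositive r X hX := by
    rw [ampliate_krausMap]
    exact posSemidef_sum _ fun j _ => hX.mul_mul_conjTranspose_same _
  tracePreserving X := by
    have h : ∀ j, (K j * X * (K j)ᴴ).trace = ((K j)ᴴ * K j * X).trace := fun j => by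
      rw [trace_mul_comm, ← mul_assoc]
    rw [krausMap_apply, trace_sum, Finset.sum_congr rfl fun j _ => h j, ← trace_sum,
      ← Finset.sum_mul, hK, one_mul]

theorem krausMap_single_apply {ι : Type*} [Fintype ι] {d : ℕ}
    (K : ι → Matrix (Fin d) (Fin d) ℂ) (l l' k k' : Fin d) :
    krausMap K (single l l' 1) k k' = ∑ j, K j k l * star (K j k' l') := by
  simp [krausMap_apply, Matrix.sum_apply, mul_apply, single_apply, ite_and]

theorem hasClassicalAction_krausMap_iff {ι : Type*} [Fintype ι] {d : ℕ}
    {K : ι → Matrix (Fin d) (Fin d) ℂ} {T : Matrix (Fin d) (Fin d) ℝ} :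
    HasClassicalAction (krausMap K) T ↔ ∀ k l, ∑ j, ‖K j k l‖ ^ 2 = T k l := by
  refine forall₂_congr fun k l => ?_
  rw [krausMap_single_apply, ← Complex.ofReal_inj]
  simp [Complex.mul_conj']

/-- Kraus decomposition of a channel, read off from a rank-one decomposition of its Choi
matrix. -/
theorem IsChannel.exists_kraus {d : ℕ} {Φ : Superop d} (hΦ : IsChannel Φ) :
    ∃ (m : ℕ) (K : Fin m → Matrix (Fin d) (Fin d) ℂ),
      Φ = krausMap K ∧ ∑ j, (K j)ᴴ * K j = 1 := by
  let ω : Fin d × Fin d → ℂ := fun p => if p.1 = p.2 then 1 else 0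
  have hpos := hΦ.completelyPositive d _ (posSemidef_vecMulVec_self_star ω)
  obtain ⟨m, v, hv⟩ := posSemidef_iff_eq_sum_vecMulVec.mp hpos
  let K : Fin m → Matrix (Fin d) (Fin d) ℂ := fun j => Matrix.of fun k l => v j (k, l)
  have hsingle : ∀ l l' : Fin d, Φ (single l l' 1) = krausMap K (single l l' 1) := by
    intro l l'
    ext k k'
    have h := congrFun (congrFun hv (k, l)) (k', l')
    have hω : (Matrix.of fun i j => vecMulVec ω (star ω) (i, l) (j, l') :
        Matrix (Fin d) (Fin d) ℂ) = single l l' 1 := by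
      ext i j
      simp only [ω, vecMulVec_apply, of_apply, single_apply, Pi.star_apply]
      by_cases hi : i = l <;> by_cases hj : j = l' <;>
        simp [hi, hj, Ne.symm]
    simp only [ampliate, of_apply, hω] at h
    rw [h, krausMap_single_apply]
    simp [K, Matrix.sum_apply, vecMulVec_apply]
  have hΦK : Φ = krausMap K := by
    refine Matrix.ext_linearMap ℂ fun l l' => LinearMap.ext_ring ?_
    simpa using hsingle l l'
  refine ⟨m, K, hΦK, ?_⟩
  ext i j
  have h := hΦ.tracePreserving (single j i 1)
  rw [hΦK] at h
  simp only [trace, diag_apply, krausMap_single_apply] at h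
  rw [Finset.sum_comm] at h
  simp only [Matrix.sum_apply, mul_apply, conjTranspose_apply]
  rw [Finset.sum_congr rfl fun x _ => Finset.sum_congr rfl fun y _ => mul_comm _ _, h]
  simp [single_apply, one_apply, ite_and]

theorem trace_conjTranspose_mul {m n : Type*} [Fintype m] [Fintype n] (A B : Matrix m n ℂ) :
    (Aᴴ * B).trace = star (Function.uncurry A) ⬝ᵥ Function.uncurry B := by
  simp only [trace, diag_apply, mul_apply, conjTranspose_apply, dotProduct, Pi.star_apply,
    Fintype.sum_prod_type_right, Function.uncurry]

theorem posSemidef_one_sub_sum_vecMulVec {n ι : Type*} [Fintype n] [DecidableEq n] [Fintype ι]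
    [DecidableEq ι] {w : ι → n → ℂ} (hw : ∀ i j, star (w i) ⬝ᵥ w j = if i = j then 1 else 0) :
    (1 - ∑ i, vecMulVec (w i) (star (w i))).PosSemidef := by
  have hherm : (∑ i, vecMulVec (w i) (star (w i)))ᴴ = ∑ i, vecMulVec (w i) (star (w i)) := by
    simp [conjTranspose_sum, conjTranspose_vecMulVec]
  have hidem : (∑ i, vecMulVec (w i) (star (w i))) * (∑ i, vecMulVec (w i) (star (w i))) =
      ∑ i, vecMulVec (w i) (star (w i)) := by
    simp [Finset.sum_mul, Finset.mul_sum, vecMulVec_mul_vecMulVec, hw, ite_smul,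
      apply_ite (vecMulVec _)]
  set Q := ∑ i, vecMulVec (w i) (star (w i))
  have h : 1 - Q = (1 - Q)ᴴ * (1 - Q) := by
    rw [conjTranspose_sub, conjTranspose_one, hherm]
    simp [sub_mul, mul_sub, hidem]
  rw [h]
  exact posSemidef_conjTranspose_mul_self _

/-- Channels that send some pure input to pairwise orthogonal pure outputs are perfectly
distinguishable. -/
theorem perfectlyDistinguishable_of_ampliate_eq {d r M : ℕ} (hM : 0 < M) {Φ : Fin M → Superop d}
    {ψ : Fin d × Fin r → ℂ} (hψ : star ψ ⬝ᵥ ψ = 1) {w : Fin M → Fin d × Fin r → ℂ}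
    (hw : ∀ i j, star (w i) ⬝ᵥ w j = if i = j then 1 else 0)
    (hΦ : ∀ m, ampliate (Φ m) r (vecMulVec ψ (star ψ)) = vecMulVec (w m) (star (w m))) :
    PerfectlyDistinguishable Φ := by
  have hM' : (M : ℂ) ≠ 0 := by exact_mod_cast hM.ne'
  let Q := ∑ i, vecMulVec (w i) (star (w i))
  refine ⟨r, vecMulVec ψ (star ψ),
    fun m => vecMulVec (w m) (star (w m)) + (M : ℂ)⁻¹ • (1 - Q),
    ⟨posSemidef_vecMulVec_self_star ψ, ?_⟩, ⟨fun m => ?_, ?_⟩, ?_⟩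
  · rw [trace_vecMulVec, dotProduct_comm, hψ]
  · refine (posSemidef_vecMulVec_self_star _).add ((posSemidef_one_sub_sum_vecMulVec hw).smul ?_)
    simp
  · rw [Finset.sum_add_distrib, Finset.sum_const, Finset.card_univ, Fintype.card_fin,
      ← Nat.cast_smul_eq_nsmul ℂ, smul_smul, mul_inv_cancel₀ hM', one_smul]
    exact add_sub_cancel _ _
  · have hQ : ∀ m, Q *ᵥ w m = w m := fun m => by
      simp [Q, sum_mulVec, vecMulVec_mulVec, hw, ite_smul]
    have htr : ∀ m, ((vecMulVec (w m) (star (w m)) + (M : ℂ)⁻¹ • (1 - Q)) *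
        vecMulVec (w m) (star (w m))).trace = 1 := fun m => by
      rw [mul_vecMulVec, trace_vecMulVec, dotProduct_comm, add_mulVec, smul_mulVec, sub_mulVec,
        hQ, one_mulVec, sub_self, smul_zero, add_zero, vecMulVec_mulVec]
      simp [hw]
    simp only [successProb, hΦ, htr]
    simp [hM.ne']

/-- Channels with Kraus operators `K m 0`, `K m 1`, the second of which annihilates an input
that the first ones send to pairwise orthogonal outputs. -/
theorem mem_distinguishableCounts_of_kraus {d r M : ℕ} (hM : 0 < M)
    {T : Matrix (Fin d) (Fin d) ℝ} (K : Fin M → Fin 2 → Matrix (Fin d) (Fin d) ℂ)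
    (hK : ∀ m, ∑ j, (K m j)ᴴ * K m j = 1) (hT : ∀ m k l, ∑ j, ‖K m j k l‖ ^ 2 = T k l)
    (Ψ : Matrix (Fin d) (Fin r) ℂ) (hΨ : (Ψᴴ * Ψ).trace = 1) (hzero : ∀ m, K m 1 * Ψ = 0)
    (horth : ∀ m n, m ≠ n → ((K m 0 * Ψ)ᴴ * (K n 0 * Ψ)).trace = 0) :
    M ∈ distinguishableCounts T := by
  refine ⟨fun m => krausMap (K m), fun m => isChannel_krausMap (hK m),
    fun m => hasClassicalAction_krausMap_iff.2 (hT m),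
    perfectlyDistinguishable_of_ampliate_eq hM (ψ := Function.uncurry Ψ)
      (w := fun m => Function.uncurry (K m 0 * Ψ)) ?_ ?_ ?_⟩
  · rw [← trace_conjTranspose_mul, hΨ]
  · intro m n
    rw [← trace_conjTranspose_mul]
    split_ifs with h
    · subst h
      have h1 := congrArg (fun A => (Ψᴴ * A * Ψ).trace) (hK m)
      simp only [Fin.sum_univ_two, Matrix.mul_add, Matrix.add_mul, Matrix.mul_assoc, hzero,
        Matrix.mul_zero, add_zero, Matrix.one_mul, hΨ] at h1
      rw [conjTranspose_mul, Matrix.mul_assoc, h1]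
    · exact horth m n h
  · intro m
    have h0 : Function.uncurry (0 : Matrix (Fin d) (Fin r) ℂ) = 0 := rfl
    simp [ampliate_krausMap_vecMulVec, hzero, h0]

/-- For perfectly distinguishable channels some pure input, reshaped into a matrix `Ψ`, is sent by
Kraus operators of different channels to orthogonal outputs. -/
theorem exists_input_of_perfectlyDistinguishable {d M : ℕ} {s : Fin M → ℕ}
    {K : ∀ m, Fin (s m) → Matrix (Fin d) (Fin d) ℂ} (hK : ∀ m, ∑ j, (K m j)ᴴ * K m j = 1)
    (h : PerfectlyDistinguishable fun m => krausMap (K m)) :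
    ∃ (r : ℕ) (Ψ : Matrix (Fin d) (Fin r) ℂ), Ψ ≠ 0 ∧
      ∀ m n, m ≠ n → ∀ i j, ((K m i * Ψ)ᴴ * (K n j * Ψ)).trace = 0 := by
  obtain ⟨r, ρ, E, hρ, hE, hsucc⟩ := h
  obtain ⟨t, v, hv⟩ := posSemidef_iff_eq_sum_vecMulVec.mp hρ.posSemidef
  let Ψ : Fin t → Matrix (Fin d) (Fin r) ℂ := fun p => Matrix.of fun i j => v p (i, j)
  have hΨ : ∀ p, v p = Function.uncurry (Ψ p) := fun p => rfl
  let w : ∀ m, Fin (s m) → Fin t → Fin d × Fin r → ℂ :=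
    fun m j p => Function.uncurry (K m j * Ψ p)
  have hσ : ∀ m, ampliate (krausMap (K m)) r ρ =
      ∑ p, ∑ j, vecMulVec (w m j p) (star (w m j p)) := by
    intro m
    rw [hv, ampliate_sum]
    refine Finset.sum_congr rfl fun p _ => ?_
    rw [hΨ, ampliate_krausMap_vecMulVec]
  have htr : ∀ n m, (E n * ampliate (krausMap (K m)) r ρ).trace =
      ∑ p, ∑ j, star (w m j p) ⬝ᵥ (E n *ᵥ w m j p) := by
    intro n m
    rw [hσ]
    simp only [Finset.mul_sum, trace_sum, mul_vecMulVec, trace_vecMulVec]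
    exact Finset.sum_congr rfl fun p _ => Finset.sum_congr rfl fun j _ => dotProduct_comm _ _
  have hnn : ∀ n m j p, 0 ≤ star (w m j p) ⬝ᵥ (E n *ᵥ w m j p) :=
    fun n m j p => (hE.posSemidef n).dotProduct_mulVec_nonneg _
  have htrnn : ∀ n m, 0 ≤ (E n * ampliate (krausMap (K m)) r ρ).trace := fun n m => by
    rw [htr]
    exact Finset.sum_nonneg fun p _ => Finset.sum_nonneg fun j _ => hnn n m j p
  have hrow : ∀ m, ∑ n, (E n * ampliate (krausMap (K m)) r ρ).trace = 1 := fun m => by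
    rw [← trace_sum, ← Finset.sum_mul, hE.sum_eq_one, one_mul,
      trace_ampliate (isChannel_krausMap (hK m)), hρ.trace_eq_one]
  have hrow' : ∀ m, ∑ n, ((E n * ampliate (krausMap (K m)) r ρ).trace).re = 1 := fun m => by
    rw [← Complex.re_sum, hrow, Complex.one_re]
  have hre : ∀ n m, 0 ≤ ((E n * ampliate (krausMap (K m)) r ρ).trace).re :=
    fun n m => (Complex.le_def.1 (htrnn n m)).1
  have hle : ∀ m, ((E m * ampliate (krausMap (K m)) r ρ).trace).re ≤ 1 := fun m => by
    rw [← hrow' m]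
    exact Finset.single_le_sum (f := fun n => ((E n * ampliate (krausMap (K m)) r ρ).trace).re)
      (fun n _ => hre n m) (Finset.mem_univ m)
  have hdiag : ∀ m, ((E m * ampliate (krausMap (K m)) r ρ).trace).re = 1 := by
    have hM : (M : ℝ) ≠ 0 := by
      rintro h0
      simp [successProb, h0] at hsucc
    have hsum : ∑ m, ((E m * ampliate (krausMap (K m)) r ρ).trace).re = ∑ _m : Fin M, (1 : ℝ) := by
      rw [successProb] at hsucc
      field_simp at hsucc
      simpa using hsucc
    exact fun m => (Finset.sum_eq_sum_iff_of_le fun m _ => hle m).1 hsum m (Finset.mem_univ m)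
  have hoff : ∀ n m, n ≠ m → (E n * ampliate (krausMap (K m)) r ρ).trace = 0 := by
    intro n m hnm
    have h1 : ∑ n ∈ Finset.univ.erase m, ((E n * ampliate (krausMap (K m)) r ρ).trace).re = 0 := by
      have := Finset.add_sum_erase Finset.univ
        (fun n => ((E n * ampliate (krausMap (K m)) r ρ).trace).re) (Finset.mem_univ m)
      rw [hrow', hdiag] at this
      linarith
    have h2 := (Finset.sum_eq_zero_iff_of_nonneg fun n _ => hre n m).1 h1 n (by simp [hnm])
    exact Complex.ext h2 (Complex.le_def.1 (htrnn n m)).2.symm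
  have hzero : ∀ n m, n ≠ m → ∀ j p, E n *ᵥ w m j p = 0 := by
    intro n m hnm j p
    have h0 := hoff n m hnm
    rw [htr, Finset.sum_eq_zero_iff_of_nonneg
      fun p _ => Finset.sum_nonneg fun j _ => hnn n m j p] at h0
    have h1 := (Finset.sum_eq_zero_iff_of_nonneg fun j _ => hnn n m j p).1
      (h0 p (Finset.mem_univ p)) j (Finset.mem_univ j)
    exact ((hE.posSemidef n).dotProduct_mulVec_zero_iff _).1 h1
  have hself : ∀ m j p, E m *ᵥ w m j p = w m j p := by
    intro m j p
    have h1 : (∑ n, E n) *ᵥ w m j p = w m j p := by rw [hE.sum_eq_one, one_mulVec]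
    rw [sum_mulVec, Finset.sum_eq_single m (fun n _ hn => hzero n m hn j p) (by simp)] at h1
    exact h1
  obtain ⟨p, hp⟩ : ∃ p, v p ≠ 0 := by
    by_contra! hall
    have := hρ.trace_eq_one
    simp [hv, hall] at this
  refine ⟨r, Ψ p, fun h0 => hp ?_, fun m n hmn i j => ?_⟩
  · rw [hΨ, h0]
    rfl
  · rw [trace_conjTranspose_mul]
    change star (w m i p) ⬝ᵥ w n j p = 0
    rw [← hself m i p, star_mulVec, ← dotProduct_mulVec, (hE.posSemidef m).isHermitian.eq,
      hzero m n hmn, dotProduct_zero]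

theorem sum_finrank_le_of_trace_orthogonal {ι m n : Type*} [Fintype ι] [DecidableEq ι] [Fintype m]
    [Fintype n] {V : ι → Submodule ℂ (Matrix m n ℂ)} {W : Submodule ℂ (Matrix m n ℂ)}
    (hVW : ∀ i, V i ≤ W) (hV : ∀ i j, i ≠ j → ∀ x ∈ V i, ∀ y ∈ V j, (xᴴ * y).trace = 0) :
    ∑ i, Module.finrank ℂ (V i) ≤ Module.finrank ℂ W := by
  let f : (∀ i, V i) →ₗ[ℂ] W := LinearMap.lsum ℂ (fun i => V i) ℂ
    fun i => Submodule.inclusion (hVW i)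
  have hf : ∀ x, (f x : Matrix m n ℂ) = ∑ i, (x i : Matrix m n ℂ) := fun x => by
    simp [f, LinearMap.lsum_apply]
  have hinj : Function.Injective f := by
    rw [← LinearMap.ker_eq_bot, LinearMap.ker_eq_bot']
    intro x hx
    ext1 j
    have h0 : ∑ i, (x i : Matrix m n ℂ) = 0 := by rw [← hf, hx]; rfl
    have h1 : ((x j : Matrix m n ℂ)ᴴ * ∑ i, (x i : Matrix m n ℂ)).trace = 0 := by simp [h0]
    rw [Matrix.mul_sum, trace_sum, Finset.sum_eq_single j
      (fun i _ hij => hV j i hij.symm _ (x j).2 _ (x i).2) (by simp),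
      trace_conjTranspose_mul_self_eq_zero_iff] at h1
    exact Subtype.ext h1
  rw [← Module.finrank_pi_fintype ℂ]
  exact LinearMap.finrank_le_finrank_of_injective hinj

/-- Right multiplication by `Ψ`. -/
def mulRightMap {d r : ℕ} (Ψ : Matrix (Fin d) (Fin r) ℂ) :
    Matrix (Fin d) (Fin d) ℂ →ₗ[ℂ] Matrix (Fin d) (Fin r) ℂ where
  toFun A := A * Ψ
  map_add' := fun A B => Matrix.add_mul A B Ψ
  map_smul' := fun c A => Matrix.smul_mul c A Ψ

theorem mulRightMap_apply {d r : ℕ} (Ψ : Matrix (Fin d) (Fin r) ℂ) (A : Matrix (Fin d) (Fin d) ℂ) :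
    mulRightMap Ψ A = A * Ψ := rfl

theorem le_finrank_ker_mulRightMap {d r : ℕ} {Ψ : Matrix (Fin d) (Fin r) ℂ}
    (h : LinearMap.ker (mulRightMap Ψ) ≠ ⊥) :
    d ≤ Module.finrank ℂ (LinearMap.ker (mulRightMap Ψ)) := by
  obtain ⟨A, hA, hA0⟩ := Submodule.exists_mem_ne_zero_of_ne_bot h
  rw [LinearMap.mem_ker, mulRightMap_apply] at hA
  obtain ⟨i, hi⟩ : ∃ i, A i ≠ 0 := by
    by_contra! hall
    exact hA0 (funext hall)
  have hAi : A i ᵥ* Ψ = 0 := by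
    ext q
    simpa [mul_apply, vecMul, dotProduct] using congrFun (congrFun hA i) q
  let f : (Fin d → ℂ) →ₗ[ℂ] LinearMap.ker (mulRightMap Ψ) :=
    { toFun := fun u => ⟨vecMulVec u (A i), by
        rw [LinearMap.mem_ker, mulRightMap_apply, vecMulVec_mul, hAi]
        ext
        simp [vecMulVec_apply]⟩
      map_add' := fun u v => Subtype.ext (add_vecMulVec u v _)
      map_smul' := fun c u => Subtype.ext (smul_vecMulVec c u _) }
  have hinj : Function.Injective f := by
    intro u v huv
    obtain ⟨j, hj⟩ := Function.ne_iff.1 hi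
    ext k
    have := congrFun (congrFun (congrArg Subtype.val huv) k) j
    exact mul_right_cancel₀ hj this
  simpa using LinearMap.finrank_le_finrank_of_injective hinj

theorem trace_eq_zero_of_mem_span {d r s t : ℕ} {K : Fin s → Matrix (Fin d) (Fin d) ℂ}
    {L : Fin t → Matrix (Fin d) (Fin d) ℂ} {Ψ : Matrix (Fin d) (Fin r) ℂ}
    (h : ∀ i j, ((K i * Ψ)ᴴ * (L j * Ψ)).trace = 0) {x y : Matrix (Fin d) (Fin d) ℂ}
    (hx : x ∈ Submodule.span ℂ (Set.range K)) (hy : y ∈ Submodule.span ℂ (Set.range L)) :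
    ((x * Ψ)ᴴ * (y * Ψ)).trace = 0 := by
  induction hx using Submodule.span_induction with
  | zero => simp
  | add x x' _ _ e e' => simp_all [Matrix.add_mul]
  | smul c x _ e => simp_all
  | mem x hx =>
    obtain ⟨i, rfl⟩ := hx
    induction hy using Submodule.span_induction with
    | zero => simp
    | add y y' _ _ e e' => simp_all [Matrix.add_mul, Matrix.mul_add]
    | smul c y _ e => simp_all
    | mem y hy =>
      obtain ⟨j, rfl⟩ := hy
      exact h i j

/-- A channel whose Kraus operators span a line is a unitary channel. -/
theorem exists_unitary_of_finrank_span_le_one {d s : ℕ} {K : Fin s → Matrix (Fin d) (Fin d) ℂ}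
    (hK : ∑ j, (K j)ᴴ * K j = 1)
    (h : Module.finrank ℂ (Submodule.span ℂ (Set.range K)) ≤ 1) :
    ∃ U ∈ Submodule.span ℂ (Set.range K), Uᴴ * U = 1 ∧
      ∀ k l, ‖U k l‖ ^ 2 = ∑ j, ‖K j k l‖ ^ 2 := by
  obtain ⟨⟨V, hV⟩, hVspan⟩ := finrank_le_one_iff.1 h
  choose c hc using fun j => hVspan ⟨K j, Submodule.subset_span ⟨j, rfl⟩⟩
  have hc' : ∀ j, K j = c j • V := fun j => (congrArg Subtype.val (hc j)).symm
  set t : ℝ := ∑ j, ‖c j‖ ^ 2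
  have ht : 0 ≤ t := Finset.sum_nonneg fun j _ => by positivity
  have hsq : ((√t : ℝ) : ℂ) * (√t : ℝ) = t := by rw [← Complex.ofReal_mul, Real.mul_self_sqrt ht]
  refine ⟨((√t : ℝ) : ℂ) • V, Submodule.smul_mem _ _ hV, ?_, fun k l => ?_⟩
  · rw [← hK, conjTranspose_smul, smul_mul_smul_comm, Complex.star_def, Complex.conj_ofReal, hsq]
    simp only [hc', conjTranspose_smul, smul_mul_smul_comm]
    rw [← Finset.sum_smul]
    congr 1
    simp [t, Complex.conj_mul']
  · simp [hc', mul_pow, Real.sq_sqrt ht, ← Finset.sum_mul, t]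

/-- For at least three qubit channels distinguished by the input `Ψ`, right multiplication by `Ψ` is
injective, so the Kraus spans are independent in the four-dimensional space of matrices. -/
theorem qubit_kraus_bounds {M r : ℕ} {s : Fin M → ℕ}
    {K : ∀ m, Fin (s m) → Matrix (Fin 2) (Fin 2) ℂ} (hK : ∀ m, ∑ j, (K m j)ᴴ * K m j = 1)
    {Ψ : Matrix (Fin 2) (Fin r) ℂ} (hΨ : Ψ ≠ 0)
    (horth : ∀ m n, m ≠ n → ∀ i j, ((K m i * Ψ)ᴴ * (K n j * Ψ)).trace = 0) (hM : 3 ≤ M) :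
    Function.Injective (mulRightMap Ψ) ∧
      ∑ m, Module.finrank ℂ (Submodule.span ℂ (Set.range (K m))) ≤ 4 ∧
      ∀ m, 1 ≤ Module.finrank ℂ (Submodule.span ℂ (Set.range (K m))) := by
  let V := fun m => Submodule.span ℂ (Set.range (K m))
  let V' := fun m => (V m).map (mulRightMap Ψ)
  have hKV : ∀ m j, K m j ∈ V m := fun m j => Submodule.subset_span ⟨j, rfl⟩
  have hV'ne : ∀ m, 1 ≤ Module.finrank ℂ (V' m) := by
    intro m
    rw [Submodule.one_le_finrank_iff]
    intro hbot
    have h0 : ∀ j, K m j * Ψ = 0 := fun j =>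
      (Submodule.mem_bot ℂ).1 (hbot ▸ Submodule.mem_map_of_mem (f := mulRightMap Ψ) (hKV m j))
    apply hΨ
    rw [← Matrix.one_mul Ψ, ← hK m, Matrix.sum_mul]
    exact Finset.sum_eq_zero fun j _ => by rw [Matrix.mul_assoc, h0, Matrix.mul_zero]
  have hV'orth : ∀ m n, m ≠ n → ∀ x ∈ V' m, ∀ y ∈ V' n, (xᴴ * y).trace = 0 := by
    rintro m n hmn _ ⟨x, hx, rfl⟩ _ ⟨y, hy, rfl⟩
    simp only [mulRightMap_apply]
    exact trace_eq_zero_of_mem_span (horth m n hmn) hx hy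
  have hsum : ∑ m, Module.finrank ℂ (V' m) ≤
      Module.finrank ℂ (LinearMap.range (mulRightMap Ψ)) :=
    sum_finrank_le_of_trace_orthogonal (fun m => LinearMap.map_le_range) hV'orth
  have hrn := LinearMap.finrank_range_add_finrank_ker (mulRightMap Ψ)
  have hfour : Module.finrank ℂ (Matrix (Fin 2) (Fin 2) ℂ) = 4 := by
    simp [Module.finrank_matrix]
  have hMsum : M ≤ ∑ m, Module.finrank ℂ (V' m) := by
    calc M = ∑ _m : Fin M, 1 := by simp
      _ ≤ _ := Finset.sum_le_sum fun m _ => hV'ne m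
  have hker : LinearMap.ker (mulRightMap Ψ) = ⊥ := by
    by_contra hne
    have := le_finrank_ker_mulRightMap hne
    omega
  have hinj : Function.Injective (mulRightMap Ψ) := LinearMap.ker_eq_bot.1 hker
  have hfr : ∀ m, Module.finrank ℂ (V' m) = Module.finrank ℂ (V m) := fun m =>
    ((V m).equivMapOfInjective _ hinj).finrank_eq.symm
  simp only [hfr] at hsum hV'ne
  exact ⟨hinj, hsum.trans (by omega), hV'ne⟩

theorem eq_one_half_of_four_unitaries {r : ℕ} {Ψ : Matrix (Fin 2) (Fin r) ℂ} {a b : ℝ}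
    (hΨ : Ψ ≠ 0) (hinj : Function.Injective (mulRightMap Ψ)) {U : Fin 4 → Matrix (Fin 2) (Fin 2) ℂ}
    (hU : ∀ n, (U n)ᴴ * U n = 1) (hT : ∀ n k l, ‖U n k l‖ ^ 2 = qubitAction a b k l)
    (horth : ∀ m n, m ≠ n → ((U m * Ψ)ᴴ * (U n * Ψ)).trace = 0) : a = 1 / 2 := by
  set c : ℂ := (Ψᴴ * Ψ).trace with hc
  have hc0 : c ≠ 0 := by rwa [Ne, hc, trace_conjTranspose_mul_self_eq_zero_iff]
  let S := Ψ * Ψᴴ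
  let A : Matrix (Fin 4) (Fin 2 × Fin 2) ℂ := Matrix.of fun n p => U n p.1 p.2
  let R : Matrix (Fin 4) (Fin 2 × Fin 2) ℂ := Matrix.of fun n p => (U n * S) p.1 p.2
  have hgram : (c⁻¹ • R) * Aᴴ = 1 := by
    have h : ∀ m n, (R * Aᴴ) m n = ((U n * Ψ)ᴴ * (U m * Ψ)).trace := by
      intro m n
      have h1 : ((U n * Ψ)ᴴ * (U m * Ψ)).trace = ((U n)ᴴ * (U m * S)).trace := by
        rw [conjTranspose_mul, Matrix.mul_assoc, trace_mul_comm, ← Matrix.mul_assoc,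
          Matrix.mul_assoc, Matrix.mul_assoc]
      rw [h1, trace_conjTranspose_mul, dotProduct_comm, mul_apply]
      rfl
    ext m n
    rw [Matrix.smul_mul, Matrix.smul_apply, h, one_apply]
    split_ifs with hmn
    · subst hmn
      rw [conjTranspose_mul, Matrix.mul_assoc, ← Matrix.mul_assoc (U m)ᴴ, hU, Matrix.one_mul,
        smul_eq_mul, inv_mul_cancel₀ hc0]
    · rw [horth n m (Ne.symm hmn), smul_zero]
  have hcomm : Aᴴ * (c⁻¹ • R) = 1 := (mul_eq_one_comm_of_card_eq _ _ _ (by simp)).1 hgram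
  let B : Fin 2 → Matrix (Fin 2) (Fin 2) ℂ := fun k => Matrix.of fun j l =>
    ∑ n, star (U n k j) * U n k l
  have hBS : ∀ k, B k * S = c • 1 := by
    intro k
    ext j l
    have h := congrFun (congrFun hcomm (k, j)) (k, l)
    rw [Matrix.mul_smul, Matrix.smul_apply, smul_eq_mul, inv_mul_eq_iff_eq_mul₀ hc0] at h
    simp only [mul_apply, B, of_apply, Finset.sum_mul, Matrix.smul_apply, smul_eq_mul] at h ⊢
    rw [Finset.sum_comm]
    simp only [R, A, conjTranspose_apply, of_apply, mul_apply, Finset.mul_sum] at h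
    simpa [mul_assoc, one_apply] using h
  have hB : B 0 = B 1 := by
    have h : (B 0 - B 1) * S = 0 := by rw [sub_mul, hBS, hBS, sub_self]
    have h2 : (B 0 - B 1) * Ψ = 0 := by
      exact (mul_self_mul_conjTranspose_eq_zero _ _).1 h
    exact sub_eq_zero.1 (hinj (by simpa [mulRightMap_apply] using h2))
  have h := congrFun (congrFun hB 0) 0
  have hBT : ∀ k, B k 0 0 = ((4 * qubitAction a b k 0 : ℝ) : ℂ) := by
    intro k
    simp only [B, of_apply, Complex.star_def, Complex.conj_mul']
    push_cast [← hT 0 k 0]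
    have : ∀ n, ((‖U n k 0‖ : ℂ)) ^ 2 = (‖U 0 k 0‖ : ℂ) ^ 2 := fun n => by
      exact_mod_cast (hT n k 0).trans (hT 0 k 0).symm
    simp [this]
  rw [hBT, hBT, Complex.ofReal_inj] at h
  simp [qubitAction] at h
  linarith

theorem le_of_mem_distinguishableCounts {a b : ℝ} {M : ℕ}
    (h : M ∈ distinguishableCounts (qubitAction a b)) :
    M ≤ 4 ∧ (3 ≤ M → a = b) ∧ (4 ≤ M → a = 1 / 2) := by
  by_cases hM : 3 ≤ M
  swap
  · omega
  obtain ⟨Φ, hΦ, hT, hdist⟩ := h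
  choose s K hΦK hK using fun m => (hΦ m).exists_kraus
  obtain rfl : Φ = fun m => krausMap (K m) := funext hΦK
  obtain ⟨r, Ψ, hΨ, horth⟩ := exists_input_of_perfectlyDistinguishable hK hdist
  obtain ⟨hinj, hsum, hone⟩ := qubit_kraus_bounds hK hΨ horth hM
  have hT' : ∀ m k l, ∑ j, ‖K m j k l‖ ^ 2 = qubitAction a b k l :=
    fun m => hasClassicalAction_krausMap_iff.1 (hT m)
  have hM4 : M ≤ 4 := by
    refine le_trans ?_ hsum
    calc M = ∑ _m : Fin M, 1 := by simp
      _ ≤ _ := Finset.sum_le_sum fun m _ => hone m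
  refine ⟨hM4, fun _ => ?_, fun h4 => ?_⟩
  · obtain ⟨m, hm⟩ : ∃ m, Module.finrank ℂ (Submodule.span ℂ (Set.range (K m))) ≤ 1 := by
      by_contra! hall
      have : M * 2 ≤ 4 := by
        refine le_trans ?_ hsum
        calc M * 2 = ∑ _m : Fin M, 2 := by simp
          _ ≤ _ := Finset.sum_le_sum fun m _ => hall m
      omega
    obtain ⟨U, -, hU, hUT⟩ := exists_unitary_of_finrank_span_le_one (hK m) hm
    have hU' : U * Uᴴ = 1 := mul_eq_one_comm.1 hU
    have h00 := congrFun (congrFun hU' 0) 0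
    simp only [mul_apply, Fin.sum_univ_two, conjTranspose_apply, Complex.star_def,
      Complex.mul_conj', one_apply_eq] at h00
    norm_cast at h00
    rw [hUT, hUT, hT', hT'] at h00
    simp [qubitAction] at h00
    linarith
  · obtain rfl : M = 4 := le_antisymm hM4 h4
    have hle : ∀ m, Module.finrank ℂ (Submodule.span ℂ (Set.range (K m))) ≤ 1 := by
      intro m
      simp only [Fin.sum_univ_four] at hsum
      have h0 := hone 0
      have h1 := hone 1
      have h2 := hone 2
      have h3 := hone 3
      fin_cases m <;> simp only [Fin.reduceFinMk, Fin.zero_eta, Fin.mk_one] <;> omega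
    choose U hUmem hU hUT using fun m => exists_unitary_of_finrank_span_le_one (hK m) (hle m)
    refine eq_one_half_of_four_unitaries (b := b) hΨ hinj hU
      (fun n k l => (hUT n k l).trans (hT' n k l)) fun m n hmn => ?_
    exact trace_eq_zero_of_mem_span (horth m n hmn) (hUmem m) (hUmem n)

/-- Pairwise orthogonal unitaries are distinguished with a maximally entangled input. -/
theorem mem_distinguishableCounts_of_unitaries {M : ℕ} (hM : 0 < M)
    {T : Matrix (Fin 2) (Fin 2) ℝ} (U : Fin M → Matrix (Fin 2) (Fin 2) ℂ)
    (hU : ∀ m, (U m)ᴴ * U m = 1) (hT : ∀ m k l, ‖U m k l‖ ^ 2 = T k l)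
    (horth : ∀ m n, m ≠ n → ((U m)ᴴ * U n).trace = 0) : M ∈ distinguishableCounts T := by
  have hsq : ((√(1 / 2) : ℝ) : ℂ) * (√(1 / 2) : ℝ) = 1 / 2 := by
    rw [← Complex.ofReal_mul, Real.mul_self_sqrt (by norm_num)]
    norm_num
  refine mem_distinguishableCounts_of_kraus hM (fun m => ![U m, 0]) (fun m => ?_)
    (fun m k l => ?_) (((√(1 / 2) : ℝ) : ℂ) • (1 : Matrix (Fin 2) (Fin 2) ℂ)) ?_ (fun m => ?_)
    fun m n hmn => ?_
  · simp [hU]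
  · simp [hT]
  · rw [conjTranspose_smul, smul_mul_smul_comm, Complex.star_def, Complex.conj_ofReal, hsq]
    simp
  · simp
  · simp [horth m n hmn]

/-- The matrix of the quaternion with coordinates `v`. -/
def quaternionMatrix (v : Fin 4 → ℝ) : Matrix (Fin 2) (Fin 2) ℂ :=
  !![⟨v 0, v 1⟩, ⟨-v 2, v 3⟩; ⟨v 2, v 3⟩, ⟨v 0, -v 1⟩]

theorem quaternionMatrix_conjTranspose_mul_self (v : Fin 4 → ℝ) :
    (quaternionMatrix v)ᴴ * quaternionMatrix v = ((v ⬝ᵥ v : ℝ) : ℂ) • 1 := by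
  ext i j
  fin_cases i <;> fin_cases j <;> apply Complex.ext <;>
    simp [quaternionMatrix, mul_apply, dotProduct, Fin.sum_univ_four] <;> ring

theorem trace_quaternionMatrix_conjTranspose_mul (u v : Fin 4 → ℝ) :
    ((quaternionMatrix u)ᴴ * quaternionMatrix v).trace = ((2 * (u ⬝ᵥ v) : ℝ) : ℂ) := by
  apply Complex.ext <;>
    simp [quaternionMatrix, trace_fin_two, mul_apply, dotProduct, Fin.sum_univ_four] <;> ring

theorem mem_distinguishableCounts_of_quaternions {M : ℕ} (hM : 0 < M) {a : ℝ}
    (v : Fin M → Fin 4 → ℝ) (hv : ∀ m, v m ⬝ᵥ v m = 1) (horth : ∀ m n, m ≠ n → v m ⬝ᵥ v n = 0)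
    (ha : ∀ m, v m 0 ^ 2 + v m 1 ^ 2 = a) :
    M ∈ distinguishableCounts (qubitAction a a) := by
  refine mem_distinguishableCounts_of_unitaries hM (fun m => quaternionMatrix (v m))
    (fun m => ?_) (fun m k l => ?_) fun m n hmn => ?_
  · rw [quaternionMatrix_conjTranspose_mul_self, hv, Complex.ofReal_one, one_smul]
  · have h := hv m
    have h' := ha m
    simp only [dotProduct, Fin.sum_univ_four] at h
    fin_cases k <;> fin_cases l <;>
      simp [quaternionMatrix, qubitAction, ← Complex.normSq_eq_norm_sq, Complex.normSq_apply] <;>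
      linarith
  · rw [trace_quaternionMatrix_conjTranspose_mul, horth m n hmn]
    simp

theorem four_mem_distinguishableCounts :
    4 ∈ distinguishableCounts (qubitAction (1 / 2) (1 / 2)) := by
  have h2 : √(1 / 2) * √(1 / 2) = 1 / 2 := Real.mul_self_sqrt (by norm_num)
  set h := √(1 / 2)
  refine mem_distinguishableCounts_of_quaternions (by norm_num)
    ![![h, 0, h, 0], ![h, 0, -h, 0], ![0, h, 0, h], ![0, h, 0, -h]] (fun m => ?_)
    (fun m n hmn => ?_) fun m => ?_
  · fin_cases m <;> simp [dotProduct, Fin.sum_univ_four, h2] <;> norm_num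
  · fin_cases m <;> fin_cases n <;>
      first | exact absurd rfl hmn | simp [dotProduct, Fin.sum_univ_four]
  · fin_cases m <;> simp [sq, h2]

theorem three_mem_distinguishableCounts {a : ℝ} (ha : a ∈ Set.Icc (1 / 3 : ℝ) (2 / 3)) :
    3 ∈ distinguishableCounts (qubitAction a a) := by
  obtain ⟨h1, h2⟩ := ha
  have hp : √((1 - a) / 2) * √((1 - a) / 2) = (1 - a) / 2 := Real.mul_self_sqrt (by linarith)
  have hq : √(a / 2) * √(a / 2) = a / 2 := Real.mul_self_sqrt (by linarith)
  have hx : √((3 * a - 1) / 2) * √((3 * a - 1) / 2) = (3 * a - 1) / 2 :=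
    Real.mul_self_sqrt (by linarith)
  have hy : √((2 - 3 * a) / 2) * √((2 - 3 * a) / 2) = (2 - 3 * a) / 2 :=
    Real.mul_self_sqrt (by linarith)
  have h2 : √2 * √2 = 2 := Real.mul_self_sqrt (by norm_num)
  set p := √((1 - a) / 2)
  set q := √(a / 2)
  set x := √((3 * a - 1) / 2)
  set y := √((2 - 3 * a) / 2)
  set t := √2
  refine mem_distinguishableCounts_of_quaternions (by norm_num)
    ![![p, x, q, y], ![p, -x, q, -y], ![t * q, 0, -t * p, 0]] (fun m => ?_)
    (fun m n hmn => ?_) fun m => ?_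
  · fin_cases m <;> simp [dotProduct, Fin.sum_univ_four]
    · linarith
    · linarith
    · linear_combination (q * q + p * p) * h2 + 2 * hp + 2 * hq
  · fin_cases m <;> fin_cases n <;>
      first
        | exact absurd rfl hmn
        | (simp [dotProduct, Fin.sum_univ_four]; linarith)
  · fin_cases m <;> simp
    · linear_combination hp + hx
    · linear_combination hp + hx
    · linear_combination (q * q) * h2 + 2 * hq

theorem exists_rotation {x y : ℝ} (h : 1 / 2 ≤ x ^ 2 + y ^ 2) :
    ∃ c s t m : ℝ, c ^ 2 + s ^ 2 = 1 ∧ t ^ 2 = 1 / 2 ∧ x = t * c - m * s ∧ y = t * s + m * c := by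
  have ht : √(1 / 2) ^ 2 = 1 / 2 := Real.sq_sqrt (by norm_num)
  have hm : √(x ^ 2 + y ^ 2 - 1 / 2) ^ 2 = x ^ 2 + y ^ 2 - 1 / 2 := Real.sq_sqrt (by linarith)
  set t := √(1 / 2)
  set m := √(x ^ 2 + y ^ 2 - 1 / 2)
  have hR : x ^ 2 + y ^ 2 ≠ 0 := by linarith
  refine ⟨(t * x + m * y) / (x ^ 2 + y ^ 2), (t * y - m * x) / (x ^ 2 + y ^ 2), t, m,
    ?_, ht, ?_, ?_⟩
  · field_simp
    linear_combination (x ^ 2 + y ^ 2) * (ht + hm)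
  · field_simp
    linear_combination (-x) * (ht + hm)
  · field_simp
    linear_combination (-y) * (ht + hm)

theorem mem_distinguishableCounts_of_real_kraus {d r M : ℕ} (hM : 0 < M)
    {T : Matrix (Fin d) (Fin d) ℝ} (L : Fin M → Fin 2 → Matrix (Fin d) (Fin d) ℝ)
    (hL : ∀ m, ∑ j, (L m j)ᵀ * L m j = 1) (hT : ∀ m k l, ∑ j, L m j k l ^ 2 = T k l)
    (Ψ : Matrix (Fin d) (Fin r) ℝ) (hΨ : (Ψᵀ * Ψ).trace = 1) (hzero : ∀ m, L m 1 * Ψ = 0)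
    (horth : ∀ m n, m ≠ n → ((L m 0 * Ψ)ᵀ * (L n 0 * Ψ)).trace = 0) :
    M ∈ distinguishableCounts T := by
  have hct : ∀ {p q : ℕ} (A : Matrix (Fin p) (Fin q) ℝ),
      (A.map Complex.ofRealHom)ᴴ = Aᵀ.map Complex.ofRealHom := fun A => by
    ext i j
    simp
  have htr : ∀ {p : ℕ} (A : Matrix (Fin p) (Fin p) ℝ),
      (A.map Complex.ofRealHom).trace = (A.trace : ℂ) := fun A => by
    simp [trace]
  refine mem_distinguishableCounts_of_kraus hM (fun m j => (L m j).map Complex.ofRealHom)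
    (fun m => ?_) (fun m k l => ?_) (Ψ.map Complex.ofRealHom) ?_ (fun m => ?_) fun m n hmn => ?_
  · have h := congrArg (fun A => A.map Complex.ofRealHom) (hL m)
    simp only [Fin.sum_univ_two] at h ⊢
    simpa only [hct, ← Matrix.map_mul, Matrix.map_add _ (map_add Complex.ofRealHom),
      Matrix.map_one _ (map_zero Complex.ofRealHom) (map_one Complex.ofRealHom)] using h
  · simp [← hT m]
  · rw [hct, ← Matrix.map_mul, htr, hΨ, Complex.ofReal_one]
  · rw [← Matrix.map_mul, hzero, Matrix.map_zero _ (map_zero _)]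
  · rw [← Matrix.map_mul, ← Matrix.map_mul, hct, ← Matrix.map_mul, htr, horth m n hmn,
      Complex.ofReal_zero]

/-- A pure qubit input that two channels, differing by a sign in one output row, send to the
orthogonal states `(1, 1) / √2` and `(1, -1) / √2`. -/
theorem two_mem_distinguishableCounts_of_row {T : Matrix (Fin 2) (Fin 2) ℝ} (κ : Fin 2) {x y : ℝ}
    (hT : ∀ l, T κ l = ![x, y] l ^ 2) (hT' : ∀ k l, k ≠ κ → T k l = 1 - ![x, y] l ^ 2)
    (h1 : 1 / 2 ≤ x ^ 2 + y ^ 2) (h2 : x ^ 2 + y ^ 2 ≤ 1) : 2 ∈ distinguishableCounts T := by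
  obtain ⟨c, s, t, m, hcs, ht, rfl, rfl⟩ := exists_rotation h1
  have hR : (t * c - m * s) ^ 2 + (t * s + m * c) ^ 2 = 1 / 2 + m ^ 2 := by
    linear_combination (t ^ 2 + m ^ 2) * hcs + ht
  have hg : √(1 - 2 * m ^ 2) ^ 2 = 1 - 2 * m ^ 2 := Real.sq_sqrt (by linarith)
  set g := √(1 - 2 * m ^ 2)
  let ε : Fin 2 → ℝ := ![1, -1]
  have hε : ∀ n, ε n ^ 2 = 1 := fun n => by fin_cases n <;> simp [ε]
  let L : Fin 2 → Fin 2 → Matrix (Fin 2) (Fin 2) ℝ := fun n =>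
    ![Matrix.of fun k => if k = κ then ![t * c - m * s, t * s + m * c]
        else ![ε n * (t * c + m * s), ε n * (t * s - m * c)],
      Matrix.of fun k => if k = κ then 0 else ![-(g * s), g * c]]
  have h00 : ∀ n, (t * c - m * s) ^ 2 + (ε n * (t * c + m * s)) ^ 2 + (g * s) ^ 2 = 1 := fun n => by
    linear_combination (t * c + m * s) ^ 2 * hε n + 2 * c ^ 2 * ht + s ^ 2 * hg + hcs
  have h11 : ∀ n, (t * s + m * c) ^ 2 + (ε n * (t * s - m * c)) ^ 2 + (g * c) ^ 2 = 1 := fun n => by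
    linear_combination (t * s - m * c) ^ 2 * hε n + 2 * s ^ 2 * ht + c ^ 2 * hg + hcs
  have h01 : ∀ n, (t * c - m * s) * (t * s + m * c) +
      ε n * (t * c + m * s) * (ε n * (t * s - m * c)) - g * s * (g * c) = 0 := fun n => by
    linear_combination (t * c + m * s) * (t * s - m * c) * hε n + 2 * c * s * ht - s * c * hg
  have hL : ∀ n, ∑ j, (L n j)ᵀ * L n j = 1 := by
    intro n
    ext i j
    fin_cases κ <;> fin_cases i <;> fin_cases j <;> simp [L, mul_apply] <;>
      linarith [h00 n, h01 n, h11 n]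
  refine mem_distinguishableCounts_of_real_kraus (by norm_num) L hL (fun n k l => ?_) !![c; s] ?_
    (fun n => ?_) fun n n' hnn => ?_
  · rcases eq_or_ne k κ with rfl | hk
    · simp [hT, L]
    · rw [hT' k l hk]
      fin_cases l <;> simp [L, hk] <;> linarith [h00 n, h11 n]
  · simp [trace, mul_apply]
    linarith
  · ext i j
    fin_cases κ <;> fin_cases i <;> fin_cases j <;> simp [L, mul_apply] <;> ring
  · fin_cases n <;> fin_cases n' <;> (try exact absurd rfl hnn) <;>
    fin_cases κ <;> simp [L, ε, trace, mul_apply] <;> ring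

theorem two_mem_distinguishableCounts {a b : ℝ} (ha : a ∈ Set.Icc (0 : ℝ) 1)
    (hb : b ∈ Set.Icc (0 : ℝ) 1) (hab : |a - b| ≤ 1 / 2) :
    2 ∈ distinguishableCounts (qubitAction a b) := by
  obtain ⟨h1, h2⟩ := abs_le.1 hab
  have ha0 := Real.sq_sqrt ha.1
  have hb0 := Real.sq_sqrt hb.1
  have ha1 := Real.sq_sqrt (sub_nonneg.2 ha.2)
  have hb1 := Real.sq_sqrt (sub_nonneg.2 hb.2)
  rcases le_total a b with h | h
  · refine two_mem_distinguishableCounts_of_row 0 (x := √a) (y := √(1 - b)) (fun l => ?_)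
      (fun k l hk => ?_) (by linarith) (by linarith)
    · fin_cases l <;> simp [qubitAction, ha0, hb1]
    · obtain rfl : k = 1 := by omega
      fin_cases l <;> simp [qubitAction, ha0, hb1]
  · refine two_mem_distinguishableCounts_of_row 1 (x := √(1 - a)) (y := √b) (fun l => ?_)
      (fun k l hk => ?_) (by linarith) (by linarith)
    · fin_cases l <;> simp [qubitAction, ha1, hb0]
    · obtain rfl : k = 0 := by omega
      fin_cases l <;> simp [qubitAction, ha1, hb0]

end QubitDist

theorem mainTheorem10 (a b : ℝ) (ha : a ∈ Set.Icc (0 : ℝ) 1) (hb : b ∈ Set.Icc (0 : ℝ) 1) :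
    (0 < |a - b| ∧ |a - b| ≤ 1 / 2 →
      QubitDist.IsDistinguishabilityNumber (QubitDist.qubitAction a b) 2) ∧
    (a = b ∧ a ∈ Set.Icc (1 / 3 : ℝ) (2 / 3) \ {1 / 2} →
      QubitDist.IsDistinguishabilityNumber (QubitDist.qubitAction a b) 3) ∧
    (a = b ∧ a = 1 / 2 →
      QubitDist.IsDistinguishabilityNumber (QubitDist.qubitAction a b) 4) := by
  refine ⟨fun ⟨hpos, hle⟩ => ⟨QubitDist.two_mem_distinguishableCounts ha hb hle, fun M hM => ?_⟩,
    fun ⟨hab, hIcc, hne⟩ => ⟨hab ▸ QubitDist.three_mem_distinguishableCounts hIcc,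
      fun M hM => ?_⟩,
    fun ⟨hab, hhalf⟩ => ⟨?_, fun M hM => (QubitDist.le_of_mem_distinguishableCounts hM).1⟩⟩
  · by_contra! h
    exact sub_ne_zero.1 (abs_pos.1 hpos) ((QubitDist.le_of_mem_distinguishableCounts hM).2.1 h)
  · by_contra! h
    exact hne ((QubitDist.le_of_mem_distinguishableCounts hM).2.2 h)
  · rw [← hab, hhalf]
    exact QubitDist.four_mem_distinguishableCounts
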